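/- Let $p$ be a prime and let $G$ be a group of nilpotency class at most $2$ and of exponent $p$ (meaning $g^p=1$ for all $g\in G$; the trivial group is allowed). Write $Z(G)$ for the centre of $G$ and $[G,G]$ for its commutator subgroup; under these hypotheses both $[G,G]$ and $G/Z(G)$ are elementary abelian $p$-groups, and the rank of such a group is its dimension as a vector space over $\mathbb{F}_p$. A group $H$ with $H/Z(H)\cong G$ is called a witness to the capability of $G$, and $G$ is called capable if such a group $H$ exists. For a group $H$ let $H_1=H$, $H_{i+1}=[H_i,H]$ be the terms of its lower central series, so that $H_3=[[H,H],H]$. Suppose that $G$ is capable and that $[G,G]$ has finite rank $k$. Then $G/Z(G)$ has finite rank at most $2k+\binom{k}{2}$. Moreover, if the rank of $G/Z(G)$ is equal to $2k+\binom{k}{2}$, then there exists a witness $H$ to the capability of $G$ such that $H_3$ is cyclic (possibly trivial). (It is not assumed that $Z(G)=[G,G]$.) -/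

import Mathlib

universe u

/-- `H` is a witness to the capability of `G`: `G` is isomorphic to the central quotient of `H`. -/
def IsCapabilityWitness (G H : Type*) [Group G] [Group H] : Prop :=
  Nonempty ((H ⧸ Subgroup.center H) ≃* G)

/-- `G` is capable: it is the central quotient of some group. The witness may be taken in the
universe of `G`, since the subgroup of a witness generated by lifts of the elements of `G` is, up to isomorphism, such
a witness. -/
def IsCapable (G : Type u) [Group G] : Prop :=
  ∃ (H : Type u) (_ : Group H), IsCapabilityWitness G H

/-- `A` is an elementary abelian `p`-group of rank `r`: it is isomorphic to the additive group of
the vector space of dimension `r` over the field with `p` elements. -/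
def IsElementaryAbelianOfRank (p : ℕ) (A : Type*) [Group A] (r : ℕ) : Prop :=
  Nonempty (A ≃* Multiplicative (Fin r → ZMod p))

/-- The term `H_n` (for `n ≥ 1`) of the lower central series of `H`, with the indexing
`H_1 = H` and `H_{n+1} = [H_n, H]`. -/
def lowerCentralTerm (H : Type*) [Group H] (n : ℕ) : Subgroup H :=
  Subgroup.lowerCentralSeries (⊤ : Subgroup H) (n - 1)

/-!
Let `H` be a witness, `V = G / Z(G)`, `W = [G, G]` and `U = H_3`, all vector spaces over `𝔽_p`.
Commutators in `G` and in `H` give an alternating map `b : V × V → W` and a map `γ : W × V → U`,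
both nondegenerate on the left, and the Hall–Witt identity makes them satisfy the Jacobi identity.

Choose a functional `φ` on `U` for which `T = φ ∘ γ : W → V*` has maximal rank `a`. The vectors `v`
with `T(W, v) = 0` form a subspace of codimension at most `a`, on which the Jacobi identity makes
`T(b(v, x), y)` symmetric in `x` and `y`; since it has values in the `a`-dimensional image of `T`,
the vectors with `b(v, V) ⊆ ker T` have codimension at most `a + a(a + 1)/2`. Repeating the count
inside `ker T` with other functionals until `W` is exhausted gives
`dim V ≤ k(k + 1)/2 + a ≤ 2k + k(k - 1)/2`.

Equality forces `a = k`, so `T` is injective: the character `φ` of `H_3` already detects which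
elements of `[H, H]` are central. In `H / ker φ` the third term is cyclic, and the only new central
elements lie over elements of `Z(G)` outside `[G, G]`. Multiplying by a bimultiplicative cocycle
of `G` makes them noncentral again; such a cocycle is trivial on commutators, so the third term
does not change.
-/

open scoped commutatorElement

section BilinearMaps

variable {R V W U : Type*} [CommRing R] [AddCommGroup V] [Module R V] [AddCommGroup W] [Module R W]
  [AddCommGroup U] [Module R U]

/-- The symmetric bilinear forms `B` on `V` all of whose partial maps `B u` lie in `D`. The
bilinear form `(x, y) ↦ T (b v x) y` is of this kind, with `D` the image of `T`, when `T w v = 0`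
for all `w`. -/
def symmetricForms (D : Submodule R (Module.Dual R V)) :
    Submodule R (V →ₗ[R] Module.Dual R V) where
  carrier := {B | (∀ u v, B u v = B v u) ∧ ∀ u, B u ∈ D}
  add_mem' hB hC := ⟨fun u v => congrArg₂ (· + ·) (hB.1 u v) (hC.1 u v),
    fun u => D.add_mem (hB.2 u) (hC.2 u)⟩
  zero_mem' := ⟨fun _ _ => rfl, fun _ => D.zero_mem⟩
  smul_mem' c _ hB := ⟨fun u v => congrArg (c • ·) (hB.1 u v), fun u => D.smul_mem c (hB.2 u)⟩

/-- The vectors whose brackets with all of `V` lie in `E`: the centralizer of `V` modulo `E`. The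
dimension count is an induction on `E` along these subspaces. -/
def bracketPreimage (b : V →ₗ[R] V →ₗ[R] W) (E : Submodule R W) : Submodule R V where
  carrier := {v | ∀ u, b v u ∈ E}
  add_mem' hv hw u := by simpa using E.add_mem (hv u) (hw u)
  zero_mem' u := by simp only [map_zero, LinearMap.zero_apply, E.zero_mem]
  smul_mem' c v hv u := by simpa using E.smul_mem c (hv u)

theorem bracketPreimage_top (b : V →ₗ[R] V →ₗ[R] W) : bracketPreimage b ⊤ = ⊤ :=
  eq_top_iff.2 fun _ _ _ => trivial

theorem bracketPreimage_bot {b : V →ₗ[R] V →ₗ[R] W} (hb : b.SeparatingLeft) :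
    bracketPreimage b ⊥ = ⊥ :=
  eq_bot_iff.2 hb

/-- The Jacobi identity of the graded Lie algebra `V ⊕ W ⊕ U` with brackets `b` in degree `(1, 1)`
and `γ` in degree `(2, 1)`. -/
def IsJacobi (b : V →ₗ[R] V →ₗ[R] W) (γ : W →ₗ[R] V →ₗ[R] U) : Prop :=
  ∀ x y z, γ (b x y) z + γ (b y z) x + γ (b z x) y = 0

variable {b : V →ₗ[R] V →ₗ[R] W} {γ : W →ₗ[R] V →ₗ[R] U}

theorem IsJacobi.compr₂ (h : IsJacobi b γ) (φ : Module.Dual R U) : IsJacobi b (γ.compr₂ φ) :=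
  fun x y z => by
    simpa only [map_add, map_zero, LinearMap.compr₂_apply] using congrArg φ (h x y z)

theorem IsJacobi.apply_comm (h : IsJacobi b γ) (hb : b.IsAlt) {v : V} (hv : ∀ w, γ w v = 0)
    (x y : V) : γ (b v x) y = γ (b v y) x := by
  have := h v x y
  rw [hv, add_zero, ← hb.neg v y, map_neg] at this
  exact add_neg_eq_zero.1 this

end BilinearMaps

section LinearAlgebra

set_option maxSynthPendingDepth 3

variable {F V W U : Type*} [Field F] [AddCommGroup V] [Module F V] [AddCommGroup W] [Module F W]
  [AddCommGroup U] [Module F U]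

theorem rank_le_of_rank_inf_ker_le (f : V →ₗ[F] U) {E : Submodule F V} {S : Submodule F U}
    [FiniteDimensional F S] (hE : E.map f ≤ S) {m : ℕ}
    (hm : Module.rank F (E ⊓ LinearMap.ker f : Submodule F V) ≤ m) :
    Module.rank F E ≤ (m + Module.finrank F S : ℕ) := by
  have hker : Module.rank F (LinearMap.ker (f.domRestrict E)) ≤ m := by
    rwa [LinearMap.ker_domRestrict, (Submodule.equivSubtypeMap E _).rank_eq,
      Submodule.map_comap_subtype]
  have hrange : Module.rank F (LinearMap.range (f.domRestrict E)) ≤ Module.finrank F S := by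
    rw [LinearMap.range_domRestrict, Module.finrank_eq_rank]
    exact Submodule.rank_mono hE
  rw [← Cardinal.lift_le_nat_iff, ← LinearMap.lift_rank_range_add_rank_ker (f.domRestrict E),
    Nat.cast_add, add_comm (m : Cardinal)]
  exact add_le_add (Cardinal.lift_le_nat_iff.2 hrange) (Cardinal.lift_le_nat_iff.2 hker)

theorem exists_separating_family (D : Submodule F (Module.Dual F V)) [FiniteDimensional F D] :
    ∃ x : Fin (Module.finrank F D) → V, ∀ e ∈ D, (∀ i, e (x i) = 0) → e = 0 := by
  have hrep (φ : Module.Dual F D) : ∃ v : V, ∀ e : D, (e : Module.Dual F V) v = φ e := by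
    obtain ⟨q, rfl⟩ := (Subspace.quotDualCoannihilatorToDual_bijective D).2 φ
    obtain ⟨v, rfl⟩ := Submodule.Quotient.mk_surjective _ q
    exact ⟨v, fun _ => rfl⟩
  choose x hx using fun i => hrep ((Module.finBasis F D).coord i)
  refine ⟨x, fun e he h => congrArg Subtype.val ((Module.finBasis F D).ext_elem (x := ⟨e, he⟩)
    (y := 0) fun i => ?_)⟩
  rw [← Module.Basis.coord_apply, ← hx i ⟨e, he⟩, h i, map_zero, Finsupp.zero_apply]

theorem exists_injective_symmetricForms (D : Submodule F (Module.Dual F V))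
    [FiniteDimensional F D] :
    ∃ g : symmetricForms D →ₗ[F] (Sym2 (Fin (Module.finrank F D)) → F),
      Function.Injective g := by
  obtain ⟨x, hx⟩ := exists_separating_family D
  let g : symmetricForms D →ₗ[F] (Sym2 (Fin (Module.finrank F D)) → F) :=
    { toFun B := Sym2.lift ⟨fun i j => B.1 (x i) (x j), fun i j => B.2.1 (x i) (x j)⟩
      map_add' B C := funext fun q => by induction q; rfl
      map_smul' c B := funext fun q => by induction q; rfl }
  refine ⟨g, (injective_iff_map_eq_zero g).2 fun B hB => Subtype.ext (LinearMap.ext fun u => ?_)⟩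
  have hB_family (i j) : B.1 (x i) (x j) = 0 := congrFun hB s(i, j)
  have hB_left (i) : B.1 (x i) = 0 := hx _ (B.2.2 _) (hB_family i)
  exact hx _ (B.2.2 u) fun i => by rw [B.2.1, hB_left, LinearMap.zero_apply]

instance (D : Submodule F (Module.Dual F V)) [FiniteDimensional F D] :
    FiniteDimensional F (symmetricForms D) :=
  have ⟨g, hg⟩ := exists_injective_symmetricForms D
  Module.Finite.of_injective g hg

theorem finrank_symmetricForms_le (D : Submodule F (Module.Dual F V)) [FiniteDimensional F D] :
    Module.finrank F (symmetricForms D) ≤ (Module.finrank F D + 1).choose 2 := by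
  obtain ⟨g, hg⟩ := exists_injective_symmetricForms D
  simpa only [Module.finrank_pi, Sym2.card, Fintype.card_fin] using
    LinearMap.finrank_le_finrank_of_injective hg

theorem finrank_map_add_finrank_inf_ker (f : W →ₗ[F] U) (E : Submodule F W)
    [FiniteDimensional F E] :
    Module.finrank F (E.map f) + Module.finrank F (E ⊓ LinearMap.ker f : Submodule F W) =
      Module.finrank F E := by
  rw [← LinearMap.finrank_range_add_finrank_ker (f.domRestrict E), LinearMap.range_domRestrict,
    LinearMap.ker_domRestrict, ← Submodule.finrank_map_subtype_eq, Submodule.map_comap_subtype]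

theorem add_add_one_choose_two (m n : ℕ) :
    (m + n + 1).choose 2 = (m + 1).choose 2 + (n + 1).choose 2 + m * n := by
  rw [← Nat.cast_inj (R := ℚ)]
  push_cast [Nat.cast_choose_two]
  ring

variable {b : V →ₗ[F] V →ₗ[F] W} {γ : W →ₗ[F] V →ₗ[F] U}

theorem IsJacobi.rank_bracketPreimage_le [FiniteDimensional F W] (hb : b.IsAlt)
    {T : W →ₗ[F] Module.Dual F V} (hT : IsJacobi b T) (E : Submodule F W) {m : ℕ}
    (hm : Module.rank F (bracketPreimage b (E ⊓ LinearMap.ker T)) ≤ m) :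
    Module.rank F (bracketPreimage b E) ≤
      (m + (Module.finrank F (E.map T) + 1).choose 2 + Module.finrank F (LinearMap.range T) :
        ℕ) := by
  have hflip : (bracketPreimage b E).map T.flip ≤ LinearMap.range T.dualMap := by
    rintro _ ⟨v, -, rfl⟩
    exact ⟨Module.Dual.eval F V v, rfl⟩
  have hsymm : (bracketPreimage b E ⊓ LinearMap.ker T.flip).map (b.compr₂ T) ≤
      symmetricForms (E.map T) := by
    rintro _ ⟨v, ⟨hv, hvT⟩, rfl⟩
    exact ⟨hT.apply_comm hb (LinearMap.congr_fun hvT), fun u => ⟨_, hv u, rfl⟩⟩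
  have hker : bracketPreimage b E ⊓ LinearMap.ker T.flip ⊓ LinearMap.ker (b.compr₂ T) ≤
      bracketPreimage b (E ⊓ LinearMap.ker T) :=
    fun v hv u => ⟨hv.1.1 u, LinearMap.congr_fun hv.2 u⟩
  have hrank := rank_le_of_rank_inf_ker_le T.flip hflip <|
    rank_le_of_rank_inf_ker_le (b.compr₂ T) hsymm <| (Submodule.rank_mono hker).trans hm
  rw [LinearMap.finrank_range_dualMap_eq_finrank_range] at hrank
  refine hrank.trans (Nat.cast_le.2 ?_)
  gcongr
  exact finrank_symmetricForms_le _

theorem IsJacobi.rank_bracketPreimage_le_of_finrank_range_le [FiniteDimensional F W] (hb : b.IsAlt)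
    (hb₀ : b.SeparatingLeft) (h : IsJacobi b γ) (hγ : γ.SeparatingLeft) {a : ℕ}
    (ha : ∀ φ : Module.Dual F U, Module.finrank F (LinearMap.range (γ.compr₂ φ)) ≤ a)
    (E : Submodule F W) :
    Module.rank F (bracketPreimage b E) ≤
      (Module.finrank F E * a + (Module.finrank F E + 1).choose 2 : ℕ) := by
  induction hc : Module.finrank F E using Nat.strong_induction_on generalizing E with
  | _ c ih =>
    rcases eq_or_ne E ⊥ with rfl | hE
    · rw [bracketPreimage_bot hb₀, rank_bot]
      exact zero_le
    obtain ⟨w, hwE, hw⟩ := Submodule.exists_mem_ne_zero_of_ne_bot hE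
    obtain ⟨φ, hφ⟩ : ∃ φ : Module.Dual F U, γ.compr₂ φ w ≠ 0 := by
      by_contra! hφ
      exact hw (hγ w fun v => (Module.forall_dual_apply_eq_zero_iff F _).1
        fun φ => LinearMap.congr_fun (hφ φ) v)
    have hadd := finrank_map_add_finrank_inf_ker (γ.compr₂ φ) E
    have hpos : 0 < Module.finrank F (E.map (γ.compr₂ φ)) :=
      Module.finrank_pos_iff_exists_ne_zero.2
        ⟨⟨_, w, hwE, rfl⟩, fun h0 => hφ (congrArg Subtype.val h0)⟩
    refine ((h.compr₂ φ).rank_bracketPreimage_le hb E (ih _ (by lia) _ rfl)).trans ?_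
    rw [Nat.cast_le, ← hc, ← hadd, add_add_one_choose_two]
    nlinarith [ha φ, Nat.mul_le_mul_right a hpos]

theorem IsJacobi.exists_dual_rank_le [FiniteDimensional F W] (hb : b.IsAlt)
    (hb₀ : b.SeparatingLeft) (h : IsJacobi b γ) (hγ : γ.SeparatingLeft) :
    ∃ φ : Module.Dual F U, Module.rank F V ≤
      ((Module.finrank F W + 1).choose 2 + Module.finrank F (LinearMap.range (γ.compr₂ φ)) :
        ℕ) := by
  let r (φ : Module.Dual F U) : ℕ := Module.finrank F (LinearMap.range (γ.compr₂ φ))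
  have hr : BddAbove (Set.range r) := ⟨Module.finrank F W, by
    rintro _ ⟨φ, rfl⟩
    exact LinearMap.finrank_range_le _⟩
  obtain ⟨φ, hφ⟩ := Nat.sSup_mem (Set.range_nonempty r) hr
  have hmax (ψ : Module.Dual F U) : r ψ ≤ r φ := (le_csSup hr ⟨ψ, rfl⟩).trans hφ.ge
  have hadd := LinearMap.finrank_range_add_finrank_ker (γ.compr₂ φ)
  have hrank := (h.compr₂ φ).rank_bracketPreimage_le hb ⊤
    (h.rank_bracketPreimage_le_of_finrank_range_le hb hb₀ hγ hmax _)
  rw [bracketPreimage_top, rank_top, Submodule.map_top, top_inf_eq] at hrank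
  refine ⟨φ, hrank.trans (Nat.cast_le.2 ?_)⟩
  rw [← hadd, add_add_one_choose_two]
  lia

theorem IsJacobi.rank_le_and_exists_injective [FiniteDimensional F W] {k : ℕ}
    (hk : Module.finrank F W = k) (hb : b.IsAlt) (hb₀ : b.SeparatingLeft) (h : IsJacobi b γ)
    (hγ : γ.SeparatingLeft) :
    Module.rank F V ≤ (2 * k + k.choose 2 : ℕ) ∧
      (Module.rank F V = (2 * k + k.choose 2 : ℕ) →
        ∃ φ : Module.Dual F U, Function.Injective (γ.compr₂ φ)) := by
  obtain ⟨φ, hφ⟩ := h.exists_dual_rank_le hb hb₀ hγ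
  have hchoose : (k + 1).choose 2 = k + k.choose 2 := by
    rw [Nat.choose_succ_succ', Nat.choose_one_right]
  have hrange : Module.finrank F (LinearMap.range (γ.compr₂ φ)) ≤ k :=
    (LinearMap.finrank_range_le _).trans hk.le
  rw [hk, hchoose] at hφ
  refine ⟨hφ.trans (Nat.cast_le.2 (by lia)), fun hrank => ⟨φ, LinearMap.ker_eq_bot.1 ?_⟩⟩
  rw [hrank, Nat.cast_le] at hφ
  have hadd := LinearMap.finrank_range_add_finrank_ker (γ.compr₂ φ)
  exact Submodule.finrank_eq_zero.1 (by lia)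

end LinearAlgebra

section Commutators

variable {G H : Type*} [Group G] [Group H]

theorem commutatorElement_mem_commutator (x y : G) : ⁅x, y⁆ ∈ commutator G :=
  Subgroup.commutator_mem_commutator trivial trivial

theorem map_commutator_le (f : H →* G) : (commutator H).map f ≤ commutator G := by
  rw [commutator_def, commutator_def, Subgroup.map_commutator]
  exact Subgroup.commutator_mono le_top le_top

theorem map_commutator_of_surjective {f : H →* G} (hf : Function.Surjective f) :
    (commutator H).map f = commutator G := by
  rw [commutator_def, commutator_def, Subgroup.map_commutator,
    Subgroup.map_top_of_surjective f hf]

theorem map_mem_center_iff {f : H →* G} (hf : Function.Surjective f) {h : H} :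
    f h ∈ Subgroup.center G ↔ ∀ x, ⁅h, x⁆ ∈ f.ker := by
  rw [Subgroup.mem_center_iff, hf.forall]
  refine forall_congr' fun x => ?_
  rw [MonoidHom.mem_ker, map_commutatorElement, commutatorElement_eq_one_iff_mul_comm, eq_comm]

theorem mem_center_iff_commutatorElement_eq_one {g : G} :
    g ∈ Subgroup.center G ↔ ∀ x : G, ⁅g, x⁆ = 1 :=
  map_mem_center_iff (f := MonoidHom.id G) Function.surjective_id

theorem map_mem_center {f : H →* G} (hf : Function.Surjective f) {h : H}
    (hh : h ∈ Subgroup.center H) : f h ∈ Subgroup.center G :=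
  (map_mem_center_iff hf).2 fun x => by
    rw [mem_center_iff_commutatorElement_eq_one.1 hh x]
    exact one_mem _

theorem commutatorElement_mul_left_of_mem_center {a b c : G}
    (h : ⁅b, c⁆ ∈ Subgroup.center G) : ⁅a * b, c⁆ = ⁅a, c⁆ * ⁅b, c⁆ := by
  rw [commutatorElement_mul_left_eq_conj_mul, Subgroup.mem_center_iff.1 h a,
    mul_inv_cancel_right, Subgroup.mem_center_iff.1 h]

theorem commutatorElement_mul_right_of_mem_center {a b c : G}
    (h : ⁅a, c⁆ ∈ Subgroup.center G) : ⁅a, b * c⁆ = ⁅a, b⁆ * ⁅a, c⁆ := by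
  rw [commutatorElement_mul_right_eq_mul_conj, mul_assoc, mul_assoc,
    ← mul_assoc b, Subgroup.mem_center_iff.1 h b, mul_inv_cancel_right]

theorem commutatorElement_eq_of_inv_mul_mem_center {g g' : G}
    (hz : g'⁻¹ * g ∈ Subgroup.center G) (x : G) : ⁅g', x⁆ = ⁅g, x⁆ := by
  have hone := mem_center_iff_commutatorElement_eq_one.1 hz x
  conv_rhs => rw [← mul_inv_cancel_left g' g]
  rw [commutatorElement_mul_left_of_mem_center (hone ▸ one_mem _), hone, mul_one]

theorem commutatorElement_pow_left_of_mem_center {a b : G} (h : ⁅a, b⁆ ∈ Subgroup.center G)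
    (n : ℕ) : ⁅a ^ n, b⁆ = ⁅a, b⁆ ^ n := by
  induction n with
  | zero => rw [pow_zero, pow_zero, commutatorElement_one_left]
  | succ n ih => rw [pow_succ, commutatorElement_mul_left_of_mem_center h, ih, pow_succ]

theorem pow_mem_center_of_commutator_le_center (hG : commutator G ≤ Subgroup.center G) {p : ℕ}
    (hp : ∀ c ∈ commutator G, c ^ p = 1) (g : G) : g ^ p ∈ Subgroup.center G :=
  mem_center_iff_commutatorElement_eq_one.2 fun x => by
    rw [commutatorElement_pow_left_of_mem_center (hG (commutatorElement_mem_commutator g x)),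
      hp _ (commutatorElement_mem_commutator g x)]

/-- The pairing `x, y ↦ t ⁅ι x, y⁆` induced by a homomorphism `t` on a central subgroup `L` which
contains the commutators `⁅ι x, y⁆`. -/
def commutatorPairing {X M : Type*} [Group X] [CommGroup M] (ι : X →* H) {L : Subgroup H}
    (hL : L ≤ Subgroup.center H) (hι : ∀ x y, ⁅ι x, y⁆ ∈ L) (t : L →* M) : X →* H →* M :=
  MonoidHom.mk'
    (fun x => MonoidHom.mk' (fun y => t ⟨⁅ι x, y⁆, hι x y⟩) fun y y' => by
      rw [← map_mul]
      exact congrArg t (Subtype.ext (commutatorElement_mul_right_of_mem_center (hL (hι x y')))))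
    fun x x' => MonoidHom.ext fun y => by
      simp only [MonoidHom.mk'_apply, MonoidHom.mul_apply, ← map_mul]
      exact congrArg t (Subtype.ext
        ((congrArg (⁅·, y⁆) (map_mul ι x x')).trans
          (commutatorElement_mul_left_of_mem_center (hL (hι x' y)))))

theorem commutatorPairing_eq_one {X M : Type*} [Group X] [CommGroup M] {ι : X →* H}
    {L : Subgroup H} (hL : L ≤ Subgroup.center H) (hι : ∀ x y, ⁅ι x, y⁆ ∈ L) (t : L →* M) {x : X}
    {y : H} (h : ⁅ι x, y⁆ = 1) : commutatorPairing ι hL hι t x y = 1 :=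
  (congrArg t (Subtype.ext h)).trans (map_one t)

end Commutators

section LowerCentral

variable {G H : Type*} [Group G] [Group H]

theorem lowerCentralTerm_three (H : Type*) [Group H] :
    lowerCentralTerm H 3 = ⁅commutator H, (⊤ : Subgroup H)⁆ :=
  rfl

theorem lowerCentralTerm_three_eq_bot_iff :
    lowerCentralTerm H 3 = ⊥ ↔ commutator H ≤ Subgroup.center H :=
  Subgroup.commutator_top_right_eq_bot_iff_le_center

theorem commutatorElement_mem_lowerCentralTerm_three (h : commutator H) (x : H) :
    ⁅(h : H), x⁆ ∈ lowerCentralTerm H 3 :=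
  Subgroup.commutator_mem_commutator h.2 trivial

theorem map_lowerCentralTerm_le (f : H →* G) (n : ℕ) :
    (lowerCentralTerm H n).map f ≤ lowerCentralTerm G n := by
  rw [lowerCentralTerm, Subgroup.map_lowerCentralSeries]
  exact Subgroup.lowerCentralSeries_mono _ le_top

theorem map_lowerCentralTerm_of_surjective {f : H →* G} (hf : Function.Surjective f) (n : ℕ) :
    (lowerCentralTerm H n).map f = lowerCentralTerm G n := by
  rw [lowerCentralTerm, Subgroup.map_lowerCentralSeries, Subgroup.map_top_of_surjective f hf,
    lowerCentralTerm]

/-- The homomorphism induced by `f` on the `n`-th terms of the lower central series. -/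
def lowerCentralTermMap (f : H →* G) (n : ℕ) : lowerCentralTerm H n →* lowerCentralTerm G n :=
  (f.comp (lowerCentralTerm H n).subtype).codRestrict _ fun h =>
    map_lowerCentralTerm_le f n ⟨h, h.2, rfl⟩

theorem lowerCentralTermMap_surjective {f : H →* G} (hf : Function.Surjective f) (n : ℕ) :
    Function.Surjective (lowerCentralTermMap f n) := by
  rintro ⟨g, hg⟩
  rw [← map_lowerCentralTerm_of_surjective hf] at hg
  obtain ⟨h, hh, rfl⟩ := hg
  exact ⟨⟨h, hh⟩, rfl⟩

theorem lowerCentralTerm_three_le_ker (hG : commutator G ≤ Subgroup.center G) (f : H →* G) :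
    lowerCentralTerm H 3 ≤ f.ker := by
  rw [← Subgroup.map_eq_bot_iff, eq_bot_iff, ← lowerCentralTerm_three_eq_bot_iff.2 hG]
  exact map_lowerCentralTerm_le f 3

theorem pow_eq_one_of_mem_lowerCentralTerm_three
    (hcen : lowerCentralTerm H 3 ≤ Subgroup.center H) {p : ℕ}
    (hp : ∀ h ∈ commutator H, h ^ p ∈ Subgroup.center H) {z : H}
    (hz : z ∈ lowerCentralTerm H 3) : z ^ p = 1 := by
  let L : Subgroup H :=
    { carrier := {z | z ∈ Subgroup.center H ∧ z ^ p = 1}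
      mul_mem' := fun {a b} ha hb => ⟨mul_mem ha.1 hb.1, by
        rw [Commute.mul_pow (Subgroup.mem_center_iff.1 hb.1 a), ha.2, hb.2, one_mul]⟩
      one_mem' := ⟨one_mem _, one_pow p⟩
      inv_mem' := fun {a} ha => ⟨inv_mem ha.1, by rw [inv_pow, ha.2, inv_one]⟩ }
  suffices hL : lowerCentralTerm H 3 ≤ L from (hL hz).2
  rw [lowerCentralTerm_three, Subgroup.commutator_le]
  intro h hh x _
  have hhx := hcen (commutatorElement_mem_lowerCentralTerm_three ⟨h, hh⟩ x)
  exact ⟨hhx, (commutatorElement_pow_left_of_mem_center hhx p).symm.trans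
    (mem_center_iff_commutatorElement_eq_one.1 (hp h hh) x)⟩

theorem commutator_commutator_eq_bot {K : Subgroup H}
    (hK : ⁅K, (⊤ : Subgroup H)⁆ ≤ Subgroup.center H) :
    ⁅commutator H, K⁆ = ⊥ := by
  have hK' := Subgroup.commutator_top_right_eq_bot_iff_le_center.2 hK
  exact Subgroup.commutator_commutator_eq_bot_of_rotate
    (by rwa [Subgroup.commutator_comm ⊤ K]) hK'

theorem commutatorElement_eq_one_of_map_mem_center {π : H →* G} (hπ : Function.Surjective π)
    (hker : π.ker = Subgroup.center H) {h x : H} (hh : h ∈ commutator H)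
    (hx : π x ∈ Subgroup.center G) : ⁅h, x⁆ = 1 := by
  have hK : ⁅(Subgroup.center G).comap π, (⊤ : Subgroup H)⁆ ≤ Subgroup.center H :=
    Subgroup.commutator_le.2 fun k hk y _ => hker.le ((map_mem_center_iff hπ).1 hk y)
  exact (commutator_commutator_eq_bot hK).le (Subgroup.commutator_mem_commutator hh hx)

/-- The homomorphism induced by `f` on commutator subgroups. -/
def commutatorMap (f : H →* G) : commutator H →* commutator G :=
  (f.comp (commutator H).subtype).codRestrict _ fun h => map_commutator_le f ⟨h, h.2, rfl⟩

theorem commutatorMap_surjective {f : H →* G} (hf : Function.Surjective f) :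
    Function.Surjective (commutatorMap f) := by
  rintro ⟨g, hg⟩
  rw [← map_commutator_of_surjective hf] at hg
  obtain ⟨h, hh, rfl⟩ := hg
  exact ⟨⟨h, hh⟩, rfl⟩

end LowerCentral

section Linearization

theorem isCapabilityWitness_iff_exists_hom {G H : Type*} [Group G] [Group H] :
    IsCapabilityWitness G H ↔
      ∃ π : H →* G, Function.Surjective π ∧ π.ker = Subgroup.center H := by
  constructor
  · rintro ⟨e⟩
    exact ⟨e.toMonoidHom.comp (QuotientGroup.mk' _),
      e.surjective.comp (QuotientGroup.mk'_surjective _),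
      (MonoidHom.ker_mulEquiv_comp _ e).trans (QuotientGroup.ker_mk' _)⟩
  · rintro ⟨π, hπ, hker⟩
    exact ⟨(QuotientGroup.quotientMulEquivOfEq hker.symm).trans
      (QuotientGroup.quotientKerEquivOfSurjective π hπ)⟩

theorem exists_zmodModule_surjective_ker_eq {G : Type u} [Group G] (p : ℕ) (N : Subgroup G)
    [N.Normal] (hcomm : commutator G ≤ N) (hpow : ∀ g : G, g ^ p ∈ N) :
    ∃ (V : Type u) (_ : AddCommGroup V) (_ : Module (ZMod p) V) (s : G →* Multiplicative V),
      Function.Surjective s ∧ s.ker = N := by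
  have := Subgroup.Normal.quotient_commutative_iff_commutator_le.2 hcomm
  let _ : CommGroup (G ⧸ N) := { (inferInstance : Group (G ⧸ N)) with mul_comm := mul_comm' }
  have hexp (q : Additive (G ⧸ N)) : p • q = 0 := by
    obtain ⟨g, rfl⟩ : ∃ g : G, Additive.ofMul (g : G ⧸ N) = q := QuotientGroup.mk_surjective q
    exact (QuotientGroup.eq_one_iff (g ^ p)).2 (hpow g)
  exact ⟨Additive (G ⧸ N), inferInstance, AddCommGroup.zmodModule hexp,
    QuotientGroup.mk' N, QuotientGroup.mk'_surjective N, QuotientGroup.ker_mk' N⟩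

theorem isElementaryAbelianOfRank_of_surjective {G V : Type*} [Group G] {p : ℕ} [Fact p.Prime]
    [AddCommGroup V] [Module (ZMod p) V] [Module.Finite (ZMod p) V] {N : Subgroup G} [N.Normal]
    {s : G →* Multiplicative V} (hs : Function.Surjective s) (hker : s.ker = N) :
    IsElementaryAbelianOfRank p (G ⧸ N) (Module.finrank (ZMod p) V) :=
  ⟨(QuotientGroup.quotientMulEquivOfEq hker.symm).trans
    ((QuotientGroup.quotientKerEquivOfSurjective s hs).trans
      (Module.finBasis (ZMod p) V).equivFun.toAddEquiv.toMultiplicative)⟩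

variable {p : ℕ} {X Y A B M : Type*} [Group X] [Group Y] [AddCommGroup A] [AddCommGroup B]
  [AddCommGroup M] [Module (ZMod p) A] [Module (ZMod p) B] [Module (ZMod p) M]

theorem exists_bilinear_of_surjective {s : X →* Multiplicative A} (hs : Function.Surjective s)
    {t : Y →* Multiplicative B} (ht : Function.Surjective t) (f : X →* Y →* Multiplicative M)
    (hsf : ∀ x, s x = 1 → ∀ y, f x y = 1) (htf : ∀ y, t y = 1 → ∀ x, f x y = 1) :
    ∃ β : A →ₗ[ZMod p] B →ₗ[ZMod p] M, ∀ x y, β (s x).toAdd (t y).toAdd = (f x y).toAdd := by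
  let f₁ := s.liftOfSurjective hs ⟨f, fun x hx => MonoidHom.ext (hsf x hx)⟩
  have hf₁ (x) : f₁ (s x) = f x := MonoidHom.liftOfRightInverse_comp_apply ..
  let f₂ := t.liftOfSurjective ht ⟨f₁.flip, fun y hy => MonoidHom.ext <|
    hs.forall.2 fun x => by rw [MonoidHom.flip_apply, hf₁, htf y hy, MonoidHom.one_apply]⟩
  have hf₂ (y) : f₂ (t y) = f₁.flip y := MonoidHom.liftOfRightInverse_comp_apply ..
  let β₁ (a : A) : B →ₗ[ZMod p] M := AddMonoidHom.toZModLinearMap p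
    (MonoidHom.toAdditive (f₂.flip (Multiplicative.ofAdd a)))
  let β : A →+ B →ₗ[ZMod p] M := AddMonoidHom.mk' β₁ fun a a' => LinearMap.ext fun b =>
    congrArg Multiplicative.toAdd (map_mul (f₂ (Multiplicative.ofAdd b)) _ _)
  refine ⟨AddMonoidHom.toZModLinearMap p β, fun x y => ?_⟩
  change (f₂ (t y) (s x)).toAdd = _
  rw [hf₂, MonoidHom.flip_apply, hf₁]

end Linearization

section Brackets

variable {p : ℕ} {G H V W U : Type*} [Group G] [Group H] [AddCommGroup V] [AddCommGroup W]
  [AddCommGroup U] [Module (ZMod p) V] [Module (ZMod p) W] [Module (ZMod p) U]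

/-- `χ` detects the centre of `H`: an element of `[H, H]` all of whose commutators are killed by
`χ` is central. Dividing by the kernel of such a `χ` creates no new central elements in
`[H, H]`. -/
def IsDetecting {M : Type*} [Group M] (χ : lowerCentralTerm H 3 →* M) : Prop :=
  ∀ h : commutator H,
    (∀ x, χ ⟨⁅(h : H), x⁆, commutatorElement_mem_lowerCentralTerm_three h x⟩ = 1) →
      (h : H) ∈ Subgroup.center H

/-- The bilinear map `b` is the commutator of `G`, read through coordinates `s` (on `G / Z(G)` in
the applications) and `t` on `[G, G]`. -/
def IsCommutatorBracket (s : G →* Multiplicative V) (t : commutator G ≃* Multiplicative W)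
    (b : V →ₗ[ZMod p] V →ₗ[ZMod p] W) : Prop :=
  ∀ x y : G, b (s x).toAdd (s y).toAdd =
    (t ⟨⁅x, y⁆, commutatorElement_mem_commutator x y⟩).toAdd

/-- The bilinear map `γ` is the commutator `[H, H] × H → H_3` of an extension `π` of `G`, read
through the coordinates `s` and `t` of its images in `G` and `u` on `H_3`. -/
def IsCommutatorAction (π : H →* G) (s : G →* Multiplicative V)
    (t : commutator G ≃* Multiplicative W) (u : lowerCentralTerm H 3 →* Multiplicative U)
    (γ : W →ₗ[ZMod p] V →ₗ[ZMod p] U) : Prop :=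
  ∀ (h : commutator H) (x : H), γ (t (commutatorMap π h)).toAdd (s (π x)).toAdd =
    (u ⟨⁅(h : H), x⁆, commutatorElement_mem_lowerCentralTerm_three h x⟩).toAdd

variable {π : H →* G} {s : G →* Multiplicative V} {t : commutator G ≃* Multiplicative W}
  {u : lowerCentralTerm H 3 →* Multiplicative U} {b : V →ₗ[ZMod p] V →ₗ[ZMod p] W}
  {γ : W →ₗ[ZMod p] V →ₗ[ZMod p] U}

theorem exists_isCommutatorBracket (hG : commutator G ≤ Subgroup.center G)
    (hs : Function.Surjective s) (hker : s.ker = Subgroup.center G)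
    (t : commutator G ≃* Multiplicative W) :
    ∃ b : V →ₗ[ZMod p] V →ₗ[ZMod p] W, IsCommutatorBracket s t b := by
  refine exists_bilinear_of_surjective hs hs
    (commutatorPairing (MonoidHom.id G) hG commutatorElement_mem_commutator t.toMonoidHom)
    (fun x hx y => commutatorPairing_eq_one hG _ _ ?_)
    (fun y hy x => commutatorPairing_eq_one hG _ _ ?_)
  · exact mem_center_iff_commutatorElement_eq_one.1 (hker.le hx) y
  · exact commutatorElement_eq_one_iff_mul_comm.2 (Subgroup.mem_center_iff.1 (hker.le hy) x)

theorem IsCommutatorBracket.isAlt (hb : IsCommutatorBracket s t b)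
    (hs : Function.Surjective s) : b.IsAlt :=
  hs.forall.2 fun x => by
    refine (hb x x).trans (congrArg Multiplicative.toAdd ?_)
    exact (map_eq_one_iff t t.injective).2 (Subtype.ext (commutatorElement_self x))

theorem IsCommutatorBracket.separatingLeft (hb : IsCommutatorBracket s t b)
    (hs : Function.Surjective s) (hker : s.ker = Subgroup.center G) : b.SeparatingLeft :=
  hs.forall.2 fun x hx => hker.ge <| mem_center_iff_commutatorElement_eq_one.2 fun y =>
    congrArg Subtype.val ((map_eq_one_iff t t.injective).1 ((hb x y).symm.trans (hx _)))

theorem exists_isCommutatorAction (hπ : Function.Surjective π)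
    (hker : π.ker = Subgroup.center H) (hH : lowerCentralTerm H 3 ≤ Subgroup.center H)
    (hs : Function.Surjective s) (hsker : s.ker = Subgroup.center G)
    (t : commutator G ≃* Multiplicative W) (u : lowerCentralTerm H 3 →* Multiplicative U) :
    ∃ γ : W →ₗ[ZMod p] V →ₗ[ZMod p] U, IsCommutatorAction π s t u γ := by
  refine exists_bilinear_of_surjective
    (s := t.toMonoidHom.comp (commutatorMap π)) (t := s.comp π)
    (t.surjective.comp (commutatorMap_surjective hπ)) (hs.comp hπ)
    (commutatorPairing (commutator H).subtype hH commutatorElement_mem_lowerCentralTerm_three u)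
    (fun h hh x => commutatorPairing_eq_one hH _ _ ?_)
    (fun x hx h => commutatorPairing_eq_one hH _ _ ?_)
  · have hπh : π h = 1 := congrArg Subtype.val ((map_eq_one_iff t t.injective).1 hh)
    exact mem_center_iff_commutatorElement_eq_one.1 (hker.le hπh) x
  · exact commutatorElement_eq_one_of_map_mem_center hπ hker h.2 (hsker.le hx)

theorem IsCommutatorAction.separatingLeft (hγ : IsCommutatorAction π s t u γ)
    (hπ : Function.Surjective π) (hker : Subgroup.center H ≤ π.ker)
    (hu : Function.Injective u) : γ.SeparatingLeft := by
  refine (t.surjective.comp (commutatorMap_surjective hπ)).forall.2 fun h hh => ?_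
  have hcomm (x : H) : ⁅(h : H), x⁆ = 1 :=
    congrArg Subtype.val ((map_eq_one_iff u hu).1 ((hγ h x).symm.trans (hh _)))
  exact (map_eq_one_iff t t.injective).2
    (Subtype.ext (hker (mem_center_iff_commutatorElement_eq_one.2 hcomm)))

theorem IsCommutatorAction.isJacobi (hγ : IsCommutatorAction π s t u γ)
    (hπ : Function.Surjective π) (hs : Function.Surjective s)
    (hb : IsCommutatorBracket s t b) : IsJacobi b γ := by
  have hconj (x y : H) : s (π (x * y * x⁻¹)) = s (π y) := by
    simp only [map_mul, map_inv, mul_comm (s (π x)), mul_inv_cancel_right]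
  have happly (x y z : H) : γ (b (s (π x)).toAdd (s (π y)).toAdd) (s (π z)).toAdd =
      (u ⟨⁅⁅x, y⁆, y * z * y⁻¹⁆, commutatorElement_mem_lowerCentralTerm_three
        ⟨⁅x, y⁆, commutatorElement_mem_commutator x y⟩ _⟩).toAdd := by
    have hmap : commutatorMap π ⟨⁅x, y⁆, commutatorElement_mem_commutator x y⟩ =
        ⟨⁅π x, π y⁆, commutatorElement_mem_commutator _ _⟩ :=
      Subtype.ext (map_commutatorElement π x y)
    rw [hb, ← hmap, ← hconj y z]
    exact hγ _ _
  refine (hs.comp hπ).forall.2 fun x => (hs.comp hπ).forall.2 fun y =>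
    (hs.comp hπ).forall.2 fun z => ?_
  refine (congrArg₂ (· + ·) (congrArg₂ (· + ·) (happly x y z) (happly y z x))
    (happly z x y)).trans ?_
  rw [← toAdd_mul, ← toAdd_mul, ← map_mul, ← map_mul, toAdd_eq_zero, ← map_one u]
  exact congrArg u (Subtype.ext (commutatorElement_commutatorElement_conj_mul x y z))

theorem IsCommutatorAction.compr₂ (hγ : IsCommutatorAction π s t u γ)
    (φ : Module.Dual (ZMod p) U) :
    IsCommutatorAction π s t ((AddMonoidHom.toMultiplicative φ.toAddMonoidHom).comp u)
      (γ.compr₂ φ) :=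
  fun h x => congrArg φ (hγ h x)

theorem IsCommutatorAction.isDetecting (hγ : IsCommutatorAction π s t u γ)
    (hπ : Function.Surjective π) (hker : π.ker = Subgroup.center H)
    (hs : Function.Surjective s) (hinj : Function.Injective γ) : IsDetecting u := by
  intro h hh
  have hzero : γ (t (commutatorMap π h)).toAdd = 0 :=
    LinearMap.ext ((hs.comp hπ).forall.2 fun x => (hγ h x).trans (hh x))
  have hone : t (commutatorMap π h) = 1 := (map_eq_zero_iff γ hinj).1 hzero
  exact hker.le (congrArg Subtype.val ((map_eq_one_iff t t.injective).1 hone))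

theorem pow_eq_one_of_mem_of_mulEquiv {C : Subgroup G} (t : C ≃* Multiplicative W) (g : G)
    (hg : g ∈ C) : g ^ p = 1 := by
  have h : (⟨g, hg⟩ : C) ^ p = 1 := (map_eq_one_iff t t.injective).1 <|
    (map_pow t _ p).trans (ZModModule.char_nsmul_eq_zero p (t ⟨g, hg⟩).toAdd)
  exact congrArg Subtype.val h

theorem exists_injective_hom_lowerCentralTerm_three {H : Type u} [Group H] {π : H →* G}
    (hker : π.ker = Subgroup.center H) (hG : commutator G ≤ Subgroup.center G)
    (hpow : ∀ c ∈ commutator G, c ^ p = 1) :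
    ∃ (U : Type u) (_ : AddCommGroup U) (_ : Module (ZMod p) U)
      (u : lowerCentralTerm H 3 →* Multiplicative U), Function.Injective u := by
  have hH := (lowerCentralTerm_three_le_ker hG π).trans hker.le
  have hHpow (h : H) (hh : h ∈ commutator H) : h ^ p ∈ Subgroup.center H :=
    hker.le ((map_pow π h p).trans (hpow _ (map_commutator_le π ⟨h, hh, rfl⟩)))
  obtain ⟨U, _, _, u, -, hu⟩ := exists_zmodModule_surjective_ker_eq p
    (⊥ : Subgroup (lowerCentralTerm H 3))
    (Subgroup.commutator_le.2 fun x _ y _ => commutatorElement_eq_one_iff_mul_comm.2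
      (Subtype.ext (Subgroup.mem_center_iff.1 (hH y.2) x)))
    (fun z => Subtype.ext (pow_eq_one_of_mem_lowerCentralTerm_three hH hHpow z.2))
  exact ⟨U, _, ‹_›, u, (MonoidHom.ker_eq_bot_iff u).1 hu⟩

theorem rank_le_and_exists_isDetecting {H : Type u} [Group H] [Fact p.Prime]
    [Module.Finite (ZMod p) W] {k : ℕ} (hk : Module.finrank (ZMod p) W = k) {π : H →* G}
    (hπ : Function.Surjective π) (hker : π.ker = Subgroup.center H)
    (hG : commutator G ≤ Subgroup.center G) {s : G →* Multiplicative V}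
    (hs : Function.Surjective s) (hsker : s.ker = Subgroup.center G)
    (t : commutator G ≃* Multiplicative W) :
    Module.rank (ZMod p) V ≤ (2 * k + k.choose 2 : ℕ) ∧
      (Module.rank (ZMod p) V = (2 * k + k.choose 2 : ℕ) →
        ∃ χ : lowerCentralTerm H 3 →* Multiplicative (ZMod p), IsDetecting χ) := by
  have hH := (lowerCentralTerm_three_le_ker hG π).trans hker.le
  obtain ⟨U, _, _, u, hu⟩ := exists_injective_hom_lowerCentralTerm_three hker hG
    (pow_eq_one_of_mem_of_mulEquiv (p := p) t)
  obtain ⟨b, hb⟩ := exists_isCommutatorBracket (p := p) hG hs hsker t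
  obtain ⟨γ, hγ⟩ := exists_isCommutatorAction (p := p) hπ hker hH hs hsker t u
  obtain ⟨hle, hinj⟩ := (hγ.isJacobi hπ hs hb).rank_le_and_exists_injective hk
    (hb.isAlt hs) (hb.separatingLeft hs hsker) (hγ.separatingLeft hπ hker.ge hu)
  refine ⟨hle, fun hrank => ?_⟩
  obtain ⟨φ, hφ⟩ := hinj hrank
  exact ⟨_, (hγ.compr₂ φ).isDetecting hπ hker hs hφ⟩

end Brackets

/-- The central extension of `Q` by `A` whose cocycle is the bimultiplicative map `β`. -/
@[ext]
structure TwistedProduct {Q A : Type*} [Group Q] [CommGroup A] (β : Q →* Q →* A) where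
  /-- The component in the quotient. -/
  fst : Q
  /-- The component in the kernel. -/
  snd : A

namespace TwistedProduct

variable {Q A : Type*} [Group Q] [CommGroup A] {β : Q →* Q →* A}

instance : Mul (TwistedProduct β) := ⟨fun k l => ⟨k.fst * l.fst, k.snd * l.snd * β k.fst l.fst⟩⟩

instance : One (TwistedProduct β) := ⟨⟨1, 1⟩⟩

instance : Inv (TwistedProduct β) := ⟨fun k => ⟨k.fst⁻¹, k.snd⁻¹ * β k.fst k.fst⟩⟩

@[simp] theorem mul_fst (k l : TwistedProduct β) : (k * l).fst = k.fst * l.fst := rfl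

@[simp] theorem mul_snd (k l : TwistedProduct β) :
    (k * l).snd = k.snd * l.snd * β k.fst l.fst := rfl

@[simp] theorem one_fst : (1 : TwistedProduct β).fst = 1 := rfl

@[simp] theorem one_snd : (1 : TwistedProduct β).snd = 1 := rfl

@[simp] theorem inv_fst (k : TwistedProduct β) : k⁻¹.fst = k.fst⁻¹ := rfl

@[simp] theorem inv_snd (k : TwistedProduct β) : k⁻¹.snd = k.snd⁻¹ * β k.fst k.fst := rfl

instance : Group (TwistedProduct β) :=
  Group.ofLeftAxioms
    (fun k l m => by
      ext
      · simp only [mul_fst, mul_assoc]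
      · simp only [mul_fst, mul_snd, map_mul, MonoidHom.mul_apply]
        simp only [mul_assoc, mul_left_comm, mul_comm])
    (fun k => by ext <;> simp)
    (fun k => by ext <;> simp)

/-- The projection of a twisted product onto its quotient. -/
def fstHom (β : Q →* Q →* A) : TwistedProduct β →* Q where
  toFun := fst
  map_one' := rfl
  map_mul' _ _ := rfl

theorem fstHom_surjective (β : Q →* Q →* A) : Function.Surjective (fstHom β) :=
  fun q => ⟨⟨q, 1⟩, rfl⟩

theorem mem_center_iff {k : TwistedProduct β} :
    k ∈ Subgroup.center (TwistedProduct β) ↔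
      k.fst ∈ Subgroup.center Q ∧ ∀ q, β q k.fst = β k.fst q := by
  simp only [Subgroup.mem_center_iff]
  constructor
  · intro h
    exact ⟨fun q => congrArg fst (h ⟨q, 1⟩), fun q => by simpa using congrArg snd (h ⟨q, 1⟩)⟩
  · rintro ⟨h1, h2⟩ l
    ext
    · exact h1 l.fst
    · simp [h2, mul_comm]

theorem commutatorElement_snd (k l : TwistedProduct β) :
    ⁅k, l⁆.snd = β k.fst l.fst / β l.fst k.fst := by
  have hβ : β ⁅k, l⁆.fst = 1 :=
    Abelianization.commutator_subset_ker β (commutatorElement_mem_commutator k.fst l.fst)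
  have hkl : (⁅k, l⁆ * (l * k)).snd = (k * l).snd :=
    congrArg snd (by rw [commutatorElement_def]; group)
  rw [mul_snd, hβ, MonoidHom.one_apply, mul_one, mul_snd, mul_snd, mul_comm k.snd,
    mul_left_comm] at hkl
  exact eq_div_of_mul_eq' (mul_left_cancel hkl)

theorem snd_eq_one_of_mem_lowerCentralTerm_three {k : TwistedProduct β}
    (hk : k ∈ lowerCentralTerm (TwistedProduct β) 3) : k.snd = 1 := by
  have hβ {w : Q} (hw : w ∈ commutator Q) : β w = 1 :=
    Abelianization.commutator_subset_ker β hw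
  have hβflip {w : Q} (hw : w ∈ commutator Q) (q : Q) : β q w = 1 :=
    Abelianization.commutator_subset_ker (β q) hw
  let L : Subgroup (TwistedProduct β) :=
    { carrier := {k | k.fst ∈ commutator Q ∧ k.snd = 1}
      mul_mem' := fun {a b} ha hb => ⟨mul_mem ha.1 hb.1, by simp [ha.2, hb.2, hβ ha.1]⟩
      one_mem' := ⟨one_mem _, rfl⟩
      inv_mem' := fun {a} ha => ⟨inv_mem ha.1, by simp [ha.2, hβ ha.1]⟩ }
  suffices hL : lowerCentralTerm (TwistedProduct β) 3 ≤ L from (hL hk).2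
  rw [lowerCentralTerm_three, Subgroup.commutator_le]
  intro k hk l _
  have hkfst : k.fst ∈ commutator Q := map_commutator_le (fstHom β) ⟨k, hk, rfl⟩
  refine ⟨commutatorElement_mem_commutator k.fst l.fst, ?_⟩
  rw [commutatorElement_snd, hβ hkfst, hβflip hkfst, MonoidHom.one_apply, div_one]

theorem isCyclic_lowerCentralTerm_three (β : Q →* Q →* A) [IsCyclic (lowerCentralTerm Q 3)] :
    IsCyclic (lowerCentralTerm (TwistedProduct β) 3) := by
  refine isCyclic_of_injective (lowerCentralTermMap (fstHom β) 3) fun k l hkl =>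
    Subtype.ext (TwistedProduct.ext (congrArg Subtype.val hkl) ?_)
  rw [snd_eq_one_of_mem_lowerCentralTerm_three k.2, snd_eq_one_of_mem_lowerCentralTerm_three l.2]

end TwistedProduct

section Witness

theorem isCyclic_of_surjective_of_ker_le {A B M : Type*} [Group A] [Group B] [Group M] [IsCyclic M]
    {f : A →* B} (hf : Function.Surjective f) {χ : A →* M} (hχ : χ.ker ≤ f.ker) : IsCyclic B :=
  have : IsCyclic (A ⧸ χ.ker) :=
    isCyclic_of_injective (QuotientGroup.kerLift χ) (QuotientGroup.kerLift_injective χ)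
  isCyclic_of_surjective (QuotientGroup.lift χ.ker f hχ)
    (QuotientGroup.lift_surjective_of_surjective _ _ hf _)

variable {G H : Type*} [Group G] [Group H]

theorem isCyclic_lowerCentralTerm_of_surjective_of_ker_le {Q M : Type*} [Group Q] [Group M]
    [IsCyclic M] {f : H →* Q} (hf : Function.Surjective f) (n : ℕ)
    (χ : lowerCentralTerm H n →* M) (hχ : χ.ker.map (Subgroup.subtype _) ≤ f.ker) :
    IsCyclic (lowerCentralTerm Q n) :=
  isCyclic_of_surjective_of_ker_le (lowerCentralTermMap_surjective hf n)
    fun h hh => Subtype.ext (hχ ⟨h, hh, rfl⟩)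

theorem IsDetecting.map_eq_one {M : Type*} [Group M] {χ : lowerCentralTerm H 3 →* M}
    (hχ : IsDetecting χ) {π : H →* G} (hπ : Function.Surjective π)
    (hker : π.ker = Subgroup.center H) {h : H}
    (hh : ∀ x, ⁅h, x⁆ ∈ χ.ker.map (Subgroup.subtype _)) (hG : π h ∈ commutator G) :
    π h = 1 := by
  rw [← map_commutator_of_surjective hπ] at hG
  obtain ⟨h', hh', heq⟩ := hG
  have hz : h'⁻¹ * h ∈ Subgroup.center H := hker.le <| by
    rw [MonoidHom.mem_ker, map_mul, map_inv, heq, inv_mul_cancel]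
  rw [← heq]
  refine hker.ge (hχ ⟨h', hh'⟩ fun x => ?_)
  obtain ⟨c, hc, hcx⟩ := hh x
  have hc' : c = ⟨⁅h', x⁆, commutatorElement_mem_lowerCentralTerm_three ⟨h', hh'⟩ x⟩ :=
    Subtype.ext (hcx.trans (commutatorElement_eq_of_inv_mul_mem_center hz x).symm)
  rwa [hc'] at hc

theorem exists_central_extension_isCyclic {H : Type u} [Group H] {π : H →* G}
    (hπ : Function.Surjective π) (hker : π.ker = Subgroup.center H)
    (hH : lowerCentralTerm H 3 ≤ Subgroup.center H) {M : Type*} [Group M] [IsCyclic M]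
    {χ : lowerCentralTerm H 3 →* M} (hχ : IsDetecting χ) :
    ∃ (Q : Type u) (_ : Group Q) (ρ : Q →* G), Function.Surjective ρ ∧
      ρ.ker ≤ Subgroup.center Q ∧ IsCyclic (lowerCentralTerm Q 3) ∧
      ∀ q ∈ Subgroup.center Q, ρ q ∈ commutator G → ρ q = 1 := by
  let N : Subgroup H := χ.ker.map (Subgroup.subtype _)
  have hN : N ≤ Subgroup.center H := (Subgroup.map_subtype_le _).trans hH
  have : N.Normal := ⟨fun n hn g => by
    rwa [Subgroup.mem_center_iff.1 (hN hn) g, mul_inv_cancel_right]⟩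
  have hmk := QuotientGroup.mk'_surjective N
  have hkermk : (QuotientGroup.mk' N).ker = N := QuotientGroup.ker_mk' N
  refine ⟨H ⧸ N, inferInstance, QuotientGroup.lift N π (hN.trans hker.ge),
    QuotientGroup.lift_surjective_of_surjective _ _ hπ _, hmk.forall.2 fun h hh => ?_,
    isCyclic_lowerCentralTerm_of_surjective_of_ker_le hmk 3 χ hkermk.ge,
    hmk.forall.2 fun h hh hhG => ?_⟩
  · exact map_mem_center hmk (hker.le hh)
  · rw [map_mem_center_iff hmk, hkermk] at hh
    exact hχ.map_eq_one hπ hker hh hhG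

theorem isCapabilityWitness_twistedProduct {Q A : Type*} [Group Q] [CommGroup A] {ρ : Q →* G}
    (hρ : Function.Surjective ρ) (hker : ρ.ker ≤ Subgroup.center Q)
    (hcomm : ∀ q ∈ Subgroup.center Q, ρ q ∈ commutator G → ρ q = 1) {β : G →* G →* A}
    (hβ : ∀ z ∈ Subgroup.center G, (∀ g, β g z = β z g) → z ∈ commutator G) :
    IsCapabilityWitness G (TwistedProduct ((β.comp ρ).compl₂ ρ)) := by
  refine isCapabilityWitness_iff_exists_hom.2 ⟨ρ.comp (TwistedProduct.fstHom _),
    hρ.comp (TwistedProduct.fstHom_surjective _), Subgroup.ext fun k => ?_⟩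
  rw [TwistedProduct.mem_center_iff]
  constructor
  · intro hk
    have hone : ρ k.fst = 1 := hk
    exact ⟨hker hk, fun q => by simp [hone]⟩
  · rintro ⟨hk, hsymm⟩
    exact hcomm _ hk (hβ _ (map_mem_center hρ hk) (hρ.forall.2 hsymm))

theorem exists_hom_separating_center {p : ℕ} [Fact p.Prime] {V : Type*} [AddCommGroup V]
    [Module (ZMod p) V] {s : G →* Multiplicative V} (hker : s.ker = Subgroup.center G)
    (hne : Subgroup.center G ≠ ⊤) :
    ∃ ψ : G →* Multiplicative (ZMod p), Subgroup.center G ≤ ψ.ker ∧ ∃ g, ψ g ≠ 1 := by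
  obtain ⟨g, hg⟩ : ∃ g, g ∉ Subgroup.center G := by
    simpa [Subgroup.eq_top_iff'] using hne
  obtain ⟨φ, hφ⟩ : ∃ φ : Module.Dual (ZMod p) V, φ (s g).toAdd ≠ 0 := by
    by_contra! h
    exact hg (hker.le ((Module.forall_dual_apply_eq_zero_iff (ZMod p) _).1 h))
  refine ⟨(AddMonoidHom.toMultiplicative φ.toAddMonoidHom).comp s, fun z hz => ?_, g, hφ⟩
  have hz' : s z = 1 := hker.ge hz
  rw [MonoidHom.mem_ker, MonoidHom.comp_apply, hz', map_one]

theorem exists_pairing_mem_commutator_of_symm {G : Type u} [Group G] {p : ℕ} [Fact p.Prime]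
    (hcomm : commutator G ≤ Subgroup.center G)
    (hne : Subgroup.center G ≠ ⊤) (hpow : ∀ g : G, g ^ p ∈ commutator G) :
    ∃ (A : Type u) (_ : CommGroup A) (β : G →* G →* A),
      ∀ z ∈ Subgroup.center G, (∀ g, β g z = β z g) → z ∈ commutator G := by
  obtain ⟨V, _, _, s, -, hs⟩ := exists_zmodModule_surjective_ker_eq p (Subgroup.center G) hcomm
    fun g => hcomm (hpow g)
  obtain ⟨C, _, _, c, -, hc⟩ := exists_zmodModule_surjective_ker_eq p (commutator G) le_rfl hpow
  obtain ⟨ψ, hψ, g, hg⟩ := exists_hom_separating_center (p := p) hs hne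
  let β : G →* G →* Multiplicative C := MonoidHom.mk'
    (fun g => MonoidHom.mk' (fun g' => Multiplicative.ofAdd ((ψ g).toAdd • (c g').toAdd))
      fun a b => by rw [map_mul, toAdd_mul, smul_add, ofAdd_add])
    fun a b => by
      ext g
      simp [add_smul]
  have hβ (a b) : β a b = Multiplicative.ofAdd ((ψ a).toAdd • (c b).toAdd) := rfl
  refine ⟨Multiplicative C, inferInstance, β, fun z hz hsymm => hc.le ?_⟩
  have hψz : ψ z = 1 := hψ hz
  have hzero := hsymm g
  rw [hβ, hβ, hψz, toAdd_one, zero_smul, ofAdd_zero, ofAdd_eq_one, smul_eq_zero] at hzero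
  exact hzero.resolve_left hg

theorem lowerCentralTerm_three_eq_bot_of_center_eq_top {π : H →* G}
    (hker : π.ker = Subgroup.center H) (hG : Subgroup.center G = ⊤) :
    lowerCentralTerm H 3 = ⊥ := by
  refine lowerCentralTerm_three_eq_bot_iff.2 (le_trans ?_ hker.le)
  rw [← Subgroup.map_eq_bot_iff, eq_bot_iff, ← (commutator_eq_bot_iff_center_eq_top G).2 hG]
  exact map_commutator_le π

theorem exists_isCapabilityWitness_isCyclic {G H : Type u} [Group G] [Group H] {p : ℕ}
    [Fact p.Prime] (hG : commutator G ≤ Subgroup.center G) (hpow : ∀ g : G, g ^ p ∈ commutator G)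
    {π : H →* G} (hπ : Function.Surjective π) (hker : π.ker = Subgroup.center H) {M : Type*}
    [Group M] [IsCyclic M] {χ : lowerCentralTerm H 3 →* M} (hχ : IsDetecting χ) :
    ∃ (K : Type u) (_ : Group K),
      IsCapabilityWitness G K ∧ IsCyclic (lowerCentralTerm K 3) := by
  by_cases hab : Subgroup.center G = ⊤
  · refine ⟨H, _, isCapabilityWitness_iff_exists_hom.2 ⟨π, hπ, hker⟩, ?_⟩
    rw [lowerCentralTerm_three_eq_bot_of_center_eq_top hker hab]
    infer_instance
  have hH := (lowerCentralTerm_three_le_ker hG π).trans hker.le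
  obtain ⟨Q, _, ρ, hρ, hρker, _, hcomm⟩ := exists_central_extension_isCyclic hπ hker hH hχ
  obtain ⟨A, _, β, hβ⟩ := exists_pairing_mem_commutator_of_symm hG hab hpow
  exact ⟨_, _, isCapabilityWitness_twistedProduct hρ hρker hcomm hβ,
    TwistedProduct.isCyclic_lowerCentralTerm_three _⟩

end Witness

theorem mainTheorem4_general (p : ℕ) (hp : p.Prime) (G : Type u) [Group G]
    (hclass : lowerCentralTerm G 3 = ⊥) (hcap : IsCapable G)
    (k : ℕ) (hk : IsElementaryAbelianOfRank p (commutator G) k) :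
    ∃ r : ℕ, IsElementaryAbelianOfRank p (G ⧸ Subgroup.center G) r ∧
      r ≤ 2 * k + k.choose 2 ∧
      (r = 2 * k + k.choose 2 → (∀ g : G, g ^ p ∈ commutator G) →
        ∃ (H : Type u) (_ : Group H),
          IsCapabilityWitness G H ∧ IsCyclic (lowerCentralTerm H 3)) := by
  have : Fact p.Prime := ⟨hp⟩
  obtain ⟨H, _, hH⟩ := hcap
  obtain ⟨π, hπ, hker⟩ := isCapabilityWitness_iff_exists_hom.1 hH
  obtain ⟨t⟩ := hk
  have hG : commutator G ≤ Subgroup.center G := lowerCentralTerm_three_eq_bot_iff.1 hclass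
  obtain ⟨V, _, _, s, hs, hsker⟩ := exists_zmodModule_surjective_ker_eq p (Subgroup.center G) hG
    (pow_mem_center_of_commutator_le_center hG (pow_eq_one_of_mem_of_mulEquiv t))
  obtain ⟨hle, hdetect⟩ := rank_le_and_exists_isDetecting
    (Module.finrank_fin_fun (ZMod p)) hπ hker hG hs hsker t
  have : Module.Finite (ZMod p) V :=
    Module.rank_lt_aleph0_iff.1 (hle.trans_lt Cardinal.natCast_lt_aleph0)
  rw [← Module.finrank_eq_rank] at hle hdetect
  refine ⟨_, isElementaryAbelianOfRank_of_surjective hs hsker, Nat.cast_le.1 hle,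
    fun hrank hpow => ?_⟩
  obtain ⟨χ, hχ⟩ := hdetect (congrArg Nat.cast hrank)
  exact exists_isCapabilityWitness_isCyclic hG hpow hπ hker hχ

theorem mainTheorem4 (p : ℕ) (hp : p.Prime) (G : Type u) [Group G]
    (hexp : ∀ g : G, g ^ p = 1) (hclass : lowerCentralTerm G 3 = ⊥) (hcap : IsCapable G)
    (k : ℕ) (hk : IsElementaryAbelianOfRank p (commutator G) k) :
    ∃ r : ℕ, IsElementaryAbelianOfRank p (G ⧸ Subgroup.center G) r ∧
      r ≤ 2 * k + k.choose 2 ∧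
      (r = 2 * k + k.choose 2 →
        ∃ (H : Type u) (_ : Group H), IsCapabilityWitness G H ∧ IsCyclic (lowerCentralTerm H 3)) := by
  obtain ⟨r, hr, hle, hwitness⟩ := mainTheorem4_general p hp G hclass hcap k hk
  exact ⟨r, hr, hle, fun h => hwitness h fun g => hexp g ▸ one_mem _⟩
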